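/- For subspaces $V_1,\dots,V_n$ of a vector space over a finite field, let $h(\alpha)=\dim\langle V_i : i\in\alpha\rangle$ for $\alpha\subseteq\{1,\dots,n\}$. A function $h:2^{\{1,\dots,n\}}\to\mathbb{R}$ that arises in this way from finite-dimensional subspaces over $\mathbb{F}_q$ is called $q$-representable. It is even representable if it is $2^m$-representable for some integer $m\ge 1$, and odd representable if it is $p^m$-representable for some odd prime $p$ and some integer $m\ge 1$. A function $h:2^{\{1,\dots,n\}}\to\mathbb{R}$ is almost even (respectively almost odd) representable if there are even (respectively odd) representable functions $g_1,g_2,\dots$ on the same ground set and real numbers $c_i>0$ with $h=\lim_{i\to\infty}c_i g_i$ (pointwise); the field may vary with $i$. A matroid is identified with its rank function. Theorem. (1) Let $u_1,u_2,u_3$ be linearly independent vectors in a vector space over a finite field of characteristic $2$, and let $\Phi_1(\cdot)=\dim\langle\cdot\rangle$ be the rank function of the seven lines $$\langle u_1\rangle,\ \langle u_2\rangle,\ \langle u_3\rangle,\ \langle u_1+u_2\rangle,\ \langle u_2+u_3\rangle,\ \langle u_1+u_2+u_3\rangle,\ \langle u_1+u_3\rangle$$ (the Fano matroid). Then $\Phi_1$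 is a matroid that is even representable but not almost odd representable. (2) Let $u_1,\dots,u_5$ be linearly independent vectors in a vector space over a finite field of odd characteristic, and let $\Phi_2(\cdot)=\dim\langle\cdot\rangle$ be the rank function of the thirteen lines $$\langle u_1\rangle,\dots,\langle u_5\rangle,\ \langle u_1+u_2+u_3\rangle,\ \langle u_3+u_4+u_5\rangle,\ \langle u_1+u_2\rangle,\ \langle u_1+u_3\rangle,\ \langle u_2+u_3\rangle,\ \langle u_3+u_4\rangle,\ \langle u_3+u_5\rangle,\ \langle u_4+u_5\rangle .$$ Then $\Phi_2$ is a matroid that is odd representable but not almost even representable. -/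

import Mathlib

open Filter Topology

namespace SubspaceRank

/-- `h : 2^ι → ℝ` is the rank function of a polymatroid on the ground set `ι`. -/
structure IsPolymatroid {ι : Type*} [DecidableEq ι] (h : Finset ι → ℝ) : Prop where
  nonneg : ∀ A, 0 ≤ h A
  empty : h ∅ = 0
  mono : ∀ A B, A ⊆ B → h A ≤ h B
  submodular : ∀ A B, h (A ∪ B) + h (A ∩ B) ≤ h A + h B

/-- A matroid is an integer-valued polymatroid whose rank is bounded by the cardinality. -/
structure IsMatroid {ι : Type*} [DecidableEq ι] (h : Finset ι → ℝ) : Prop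
    extends IsPolymatroid h where
  le_card : ∀ A, h A ≤ (A.card : ℝ)
  integral : ∀ A, ∃ n : ℤ, h A = (n : ℝ)

/-- The rank function `A ↦ dim ⟨V_i : i ∈ A⟩` of an indexed family of subspaces. -/
noncomputable def subspaceRank {ι F W : Type*} [Field F] [AddCommGroup W] [Module F W]
    (V : ι → Submodule F W) (A : Finset ι) : ℝ :=
  (Module.finrank F ↥(⨆ i ∈ A, V i) : ℝ)

/-- `h` is `q`-representable: it is the rank function of a family of subspaces of a
(finite-dimensional) vector space over the field with `q` elements. -/
def IsQRepresentable {ι : Type*} (q : ℕ) (h : Finset ι → ℝ) : Prop :=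
  ∃ (F : Type) (_ : Field F) (_ : Finite F) (W : Type) (_ : AddCommGroup W) (_ : Module F W)
    (_ : FiniteDimensional F W) (V : ι → Submodule F W),
    Nat.card F = q ∧ ∀ A : Finset ι, h A = subspaceRank V A

/-- Representable over some finite field of characteristic two. -/
def IsEvenRepresentable {ι : Type*} (h : Finset ι → ℝ) : Prop :=
  ∃ m : ℕ, 0 < m ∧ IsQRepresentable (2 ^ m) h

/-- Representable over some finite field of odd characteristic. -/
def IsOddRepresentable {ι : Type*} (h : Finset ι → ℝ) : Prop :=
  ∃ p m : ℕ, p.Prime ∧ Odd p ∧ 0 < m ∧ IsQRepresentable (p ^ m) h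

/-- `h` is a limit of positive multiples of even representable rank functions. -/
def IsAlmostEvenRepresentable {ι : Type*} (h : Finset ι → ℝ) : Prop :=
  ∃ (g : ℕ → Finset ι → ℝ) (c : ℕ → ℝ), (∀ i, IsEvenRepresentable (g i)) ∧ (∀ i, 0 < c i) ∧
    Tendsto (fun i => c i • g i) atTop (𝓝 h)

/-- `h` is a limit of positive multiples of odd representable rank functions; the field may
vary along the sequence. -/
def IsAlmostOddRepresentable {ι : Type*} (h : Finset ι → ℝ) : Prop :=
  ∃ (g : ℕ → Finset ι → ℝ) (c : ℕ → ℝ), (∀ i, IsOddRepresentable (g i)) ∧ (∀ i, 0 < c i) ∧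
    Tendsto (fun i => c i • g i) atTop (𝓝 h)

/-- The seven vectors spanning `Y₁, Y₂, Y₃` (left) and `W₁, …, W₄` (right). -/
def vectors₁ {W : Type*} [AddCommGroup W] (u : Fin 3 → W) : Fin 3 ⊕ Fin 4 → W :=
  Sum.elim u ![u 0 + u 1, u 1 + u 2, u 0 + u 1 + u 2, u 0 + u 2]

/-- The thirteen vectors spanning `Z₁, …, Z₅` (left) and `V₁, …, V₈` (right). -/
def vectors₂ {W : Type*} [AddCommGroup W] (u : Fin 5 → W) : Fin 5 ⊕ Fin 8 → W :=
  Sum.elim u ![u 0 + u 1 + u 2, u 2 + u 3 + u 4, u 0 + u 1, u 0 + u 2, u 1 + u 2,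
    u 2 + u 3, u 2 + u 4, u 3 + u 4]

/-- The rank function of the lines `Y₁, Y₂, Y₃, W₁, …, W₄`. -/
noncomputable def Φ₁ (F : Type*) {W : Type*} [Field F] [AddCommGroup W] [Module F W]
    (u : Fin 3 → W) : Finset (Fin 3 ⊕ Fin 4) → ℝ :=
  subspaceRank fun x => Submodule.span F {vectors₁ u x}

/-- The rank function of the lines `Z₁, …, Z₅, V₁, …, V₈`. -/
noncomputable def Φ₂ (F : Type*) {W : Type*} [Field F] [AddCommGroup W] [Module F W]
    (u : Fin 5 → W) : Finset (Fin 5 ⊕ Fin 8) → ℝ :=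
  subspaceRank fun x => Submodule.span F {vectors₂ u x}

end SubspaceRank

/-!
Seven subspaces `A, B, C, P, Q, D, R` stand for the places of `x, y, z, x + y, y + z, x + y + z,
x + z`. The space of triples `(x, y, z)` satisfying these seven memberships has a dimension bounded
below by ranks of points and of the six Fano lines that do not depend on the characteristic. If `2`
is invertible, then `2x = (x + y) + (x + z) - (y + z)` confines `x` to `A ⊓ (P ⊔ Q ⊔ R)`; if
`2 = 0`, then `x + z = (x + y) + (y + z)` is confined to `R ⊓ (P ⊔ Q)`. Either fact bounds the
dimension from above, and comparing the bounds gives a linear rank inequality for each kind of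
characteristic. Homogeneous inequalities between ranks survive limits of positive multiples, and
the Fano configuration violates each of them over a field of the opposite kind. The
configuration `Φ₂` contains the lines of `Φ₁`.
-/

namespace SubspaceRank

open Module Submodule

section Dimension

variable {F W W' : Type*} [Field F] [AddCommGroup W] [Module F W] [FiniteDimensional F W]
  [AddCommGroup W'] [Module F W']

theorem finrank_map_add_finrank_inf_ker (f : W →ₗ[F] W') (X : Submodule F W) :
    finrank F (X.map f) + finrank F ↥(X ⊓ LinearMap.ker f) = finrank F X := by
  have h := LinearMap.finrank_range_add_finrank_ker (f.domRestrict X)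
  rwa [LinearMap.range_domRestrict, LinearMap.ker_domRestrict,
    ← finrank_map_subtype_eq, LinearMap.ker, map_comap_subtype] at h

theorem finrank_le_add_of_map_le {W'' : Type*} [AddCommGroup W''] [Module F W'']
    [FiniteDimensional F W'] [FiniteDimensional F W''] {X : Submodule F W} {f : W →ₗ[F] W'}
    {M : Submodule F W'} {φ : W'' →ₗ[F] W} {K : Submodule F W''}
    (hM : X.map f ≤ M) (hK : X ⊓ LinearMap.ker f ≤ K.map φ) :
    finrank F X ≤ finrank F M + finrank F K := by
  rw [← finrank_map_add_finrank_inf_ker f X]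
  exact add_le_add (finrank_mono hM) ((finrank_mono hK).trans (finrank_map_le φ K))

theorem finrank_prod_eq [FiniteDimensional F W'] (X : Submodule F W) (Y : Submodule F W') :
    finrank F (X.prod Y) = finrank F X + finrank F Y := by
  have h : X.prod Y = LinearMap.range (X.subtype.prodMap Y.subtype) := by
    rw [LinearMap.range_prodMap, range_subtype, range_subtype]
  rw [h, LinearMap.finrank_range_of_inj
    (Prod.map_injective.2 ⟨X.injective_subtype, Y.injective_subtype⟩), finrank_prod]

variable [FiniteDimensional F W'] {f : W →ₗ[F] W'} {X : Submodule F W} {M N : Submodule F W'}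

theorem finrank_add_finrank_le_of_map_le (P : Submodule F W') (hM : X.map f ≤ M) :
    finrank F X + finrank F P ≤ finrank F ↥(X ⊓ P.comap f) + finrank F ↥(M ⊔ P) := by
  have hker : (X ⊓ P.comap f) ⊓ LinearMap.ker f = X ⊓ LinearMap.ker f := by
    rw [inf_assoc, inf_eq_right.2 (LinearMap.ker_le_comap f)]
  have hX := finrank_map_add_finrank_inf_ker f X
  have hXP := finrank_map_add_finrank_inf_ker f (X ⊓ P.comap f)
  rw [hker, ← map_inf_eq_map_inf_comap] at hXP
  have hsup := finrank_sup_add_finrank_inf_eq (X.map f) P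
  have hmono : finrank F ↥(X.map f ⊔ P) ≤ finrank F ↥(M ⊔ P) :=
    finrank_mono (sup_le_sup_right hM P)
  omega

theorem finrank_add_finrank_add_finrank_le_of_map_le (P : Submodule F W') {E : Submodule F W'}
    (hM : X.map f ≤ M) (hN : X.map f ≤ N) (hE : E ≤ M ⊔ N ⊔ P) :
    finrank F X + finrank F P + finrank F E ≤
      finrank F ↥(X ⊓ P.comap f) + finrank F ↥(M ⊔ P) + finrank F ↥(N ⊔ P) := by
  have hX := finrank_add_finrank_le_of_map_le P (le_refl (X.map f))
  have hinf : finrank F ↥(X.map f ⊔ P) ≤ finrank F ↥((M ⊔ P) ⊓ (N ⊔ P)) :=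
    finrank_mono (le_inf (sup_le_sup_right hM P) (sup_le_sup_right hN P))
  have hsup := finrank_sup_add_finrank_inf_eq (M ⊔ P) (N ⊔ P)
  rw [← sup_sup_distrib_right] at hsup
  have := finrank_mono hE
  omega

end Dimension

theorem add_add_add_eq_of_charP_two (R : Type*) {M : Type*} [Semiring R] [CharP R 2]
    [AddCommMonoid M] [Module R M] (x y z : M) : x + y + (y + z) = x + z := by
  rw [add_assoc, ← add_assoc y, ← two_smul R y, CharTwo.two_eq_zero, zero_smul, zero_add]

section FanoTriples

variable {F W : Type*} [Field F] [AddCommGroup W] [Module F W]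

/-- The triples `(x, y, z) ∈ A × B × C` with `x + y ∈ P`, `y + z ∈ Q`, `x + y + z ∈ D` and
`x + z ∈ R`: the seven subspaces are placed like the points of the Fano plane. -/
def fanoTriples (A B C P Q D R : Submodule F W) : Submodule F (W × W × W) :=
  let x : W × W × W →ₗ[F] W := LinearMap.fst F W (W × W)
  let y : W × W × W →ₗ[F] W := LinearMap.fst F W W ∘ₗ LinearMap.snd F W (W × W)
  let z : W × W × W →ₗ[F] W := LinearMap.snd F W W ∘ₗ LinearMap.snd F W (W × W)
  A.prod (B.prod C) ⊓ P.comap (x + y) ⊓ Q.comap (y + z) ⊓ D.comap (x + y + z) ⊓ R.comap (x + z)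

theorem mem_fanoTriples {A B C P Q D R : Submodule F W} {x y z : W} :
    (x, y, z) ∈ fanoTriples A B C P Q D R ↔
      (x ∈ A ∧ y ∈ B ∧ z ∈ C) ∧ x + y ∈ P ∧ y + z ∈ Q ∧ x + y + z ∈ D ∧ x + z ∈ R := by
  simp only [fanoTriples, mem_inf, mem_prod, and_assoc]
  rfl

variable [FiniteDimensional F W] (A B C P Q D R : Submodule F W)

/- The conditions are imposed one at a time; the last two sums are already confined to two
different subspaces, so that they are cheaper than the first two. -/
theorem le_finrank_fanoTriples :
    finrank F A + finrank F B + finrank F C + finrank F P + finrank F Q + finrank F D +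
        finrank F R + 2 * finrank F ↥(A ⊔ C ⊔ D) ≤
      finrank F (fanoTriples A B C P Q D R) + finrank F ↥(A ⊔ B ⊔ P) + finrank F ↥(B ⊔ C ⊔ Q) +
        finrank F ↥(A ⊔ C ⊔ R) + finrank F ↥(C ⊔ P ⊔ D) + finrank F ↥(A ⊔ Q ⊔ D) +
        finrank F ↥(B ⊔ R ⊔ D) := by
  let x : W × W × W →ₗ[F] W := LinearMap.fst F W (W × W)
  let y : W × W × W →ₗ[F] W := LinearMap.fst F W W ∘ₗ LinearMap.snd F W (W × W)
  let z : W × W × W →ₗ[F] W := LinearMap.snd F W W ∘ₗ LinearMap.snd F W (W × W)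
  let X₀ := A.prod (B.prod C)
  let X₁ := X₀ ⊓ P.comap (x + y)
  let X₂ := X₁ ⊓ Q.comap (y + z)
  let X₃ := X₂ ⊓ D.comap (x + y + z)
  have hX₀ : finrank F X₀ = finrank F A + (finrank F B + finrank F C) := by
    rw [finrank_prod_eq, finrank_prod_eq]
  have hX₁ : finrank F X₀ + finrank F P ≤ finrank F X₁ + finrank F ↥(A ⊔ B ⊔ P) := by
    refine finrank_add_finrank_le_of_map_le P ?_
    rintro _ ⟨v, ⟨hA, hB, -⟩, rfl⟩
    exact add_mem_sup hA hB
  have hX₂ : finrank F X₁ + finrank F Q ≤ finrank F X₂ + finrank F ↥(B ⊔ C ⊔ Q) := by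
    refine finrank_add_finrank_le_of_map_le Q ?_
    rintro _ ⟨v, ⟨⟨-, hB, hC⟩, -⟩, rfl⟩
    exact add_mem_sup hB hC
  have hX₃ : finrank F X₂ + finrank F D + finrank F ↥(A ⊔ C ⊔ D) ≤
      finrank F X₃ + finrank F ↥(C ⊔ P ⊔ D) + finrank F ↥(A ⊔ Q ⊔ D) := by
    refine finrank_add_finrank_add_finrank_le_of_map_le D ?_ ?_ (by order)
    · rintro _ ⟨v, ⟨⟨⟨-, -, hC⟩, hP⟩, -⟩, rfl⟩
      exact sup_comm C P ▸ add_mem_sup hP hC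
    · rintro _ ⟨v, ⟨⟨⟨hA, -, -⟩, -⟩, hQ⟩, rfl⟩
      rw [add_assoc]
      exact add_mem_sup hA hQ
  have hX₄ : finrank F X₃ + finrank F R + finrank F ↥(A ⊔ C ⊔ D) ≤
      finrank F (fanoTriples A B C P Q D R) + finrank F ↥(A ⊔ C ⊔ R) +
        finrank F ↥(B ⊔ R ⊔ D) := by
    rw [sup_right_comm B]
    refine finrank_add_finrank_add_finrank_le_of_map_le R ?_ ?_ (by order)
    · rintro _ ⟨v, ⟨⟨⟨⟨hA, -, hC⟩, -⟩, -⟩, -⟩, rfl⟩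
      exact add_mem_sup hA hC
    · rintro _ ⟨v, ⟨⟨⟨⟨-, hB, -⟩, -⟩, -⟩, hD⟩, rfl⟩
      have hxz : (x + z) v = -y v + (x + y + z) v := by
        simp only [LinearMap.add_apply]
        abel
      exact hxz ▸ add_mem_sup (neg_mem hB) hD
  omega

variable {A B C P Q D R}

-- `2x = (x + y) + (x + z) - (y + z)`, and a triple with `x = 0` lies in `0 × (B ⊓ P) × (C ⊓ R)`.
theorem finrank_fanoTriples_le_of_two_ne_zero (h2 : (2 : F) ≠ 0) :
    finrank F (fanoTriples A B C P Q D R) ≤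
      finrank F ↥(A ⊓ (P ⊔ Q ⊔ R)) + finrank F ↥(B ⊓ P) + finrank F ↥(C ⊓ R) := by
  rw [add_assoc, ← finrank_prod_eq]
  refine finrank_le_add_of_map_le (f := LinearMap.fst F W (W × W))
    (φ := LinearMap.inr F W (W × W)) ?_ ?_
  · rintro _ ⟨⟨x, y, z⟩, hT, rfl⟩
    obtain ⟨⟨hx, -, -⟩, hP, hQ, -, hR⟩ := mem_fanoTriples.1 hT
    have h2x : (2 : F) • x = x + y - (y + z) + (x + z) := by
      rw [two_smul]
      abel
    exact ⟨hx, (smul_mem_iff _ h2).1 (h2x ▸ add_mem_sup (sub_mem_sup hP hQ) hR)⟩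
  · rintro ⟨x, y, z⟩ ⟨hT, rfl : x = 0⟩
    obtain ⟨⟨-, hy, hz⟩, hP, -, -, hR⟩ := mem_fanoTriples.1 hT
    rw [zero_add] at hP hR
    exact ⟨(y, z), ⟨⟨hy, hP⟩, ⟨hz, hR⟩⟩, rfl⟩

-- `x + z = (x + y) + (y + z)`, and a triple with `x + z = 0` is `(x, y, -x)` with `x ∈ A ⊓ C`
-- and `y = x + y + z ∈ B ⊓ D`.
theorem finrank_fanoTriples_le_of_charP_two [CharP F 2] :
    finrank F (fanoTriples A B C P Q D R) ≤
      finrank F ↥(R ⊓ (P ⊔ Q)) + finrank F ↥(A ⊓ C) + finrank F ↥(B ⊓ D) := by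
  rw [add_assoc, ← finrank_prod_eq]
  refine finrank_le_add_of_map_le
    (f := LinearMap.fst F W (W × W) + LinearMap.snd F W W ∘ₗ LinearMap.snd F W (W × W))
    (φ := (LinearMap.fst F W W).prod ((LinearMap.snd F W W).prod (-LinearMap.fst F W W))) ?_ ?_
  · rintro _ ⟨⟨x, y, z⟩, hT, rfl⟩
    obtain ⟨-, hP, hQ, -, hR⟩ := mem_fanoTriples.1 hT
    have hPQ : x + z ∈ P ⊔ Q := add_add_add_eq_of_charP_two F x y z ▸ add_mem_sup hP hQ
    exact ⟨hR, hPQ⟩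
  · rintro ⟨x, y, z⟩ ⟨hT, hxz : x + z = 0⟩
    obtain rfl : z = -x := eq_neg_of_add_eq_zero_right hxz
    obtain ⟨⟨hx, hy, hz⟩, -, -, hD, -⟩ := mem_fanoTriples.1 hT
    rw [neg_mem_iff] at hz
    rw [add_right_comm, hxz, zero_add] at hD
    exact ⟨(x, y), ⟨⟨hx, hz⟩, ⟨hy, hD⟩⟩, rfl⟩

end FanoTriples

section Inequalities

open Sum (inl inr)

/-- The rank that `A` and `B` have in common. On a rank function of subspaces it is the dimension
of the intersection of the two spans. -/
def mutualRank {ι : Type*} [DecidableEq ι] (h : Finset ι → ℝ) (A B : Finset ι) : ℝ :=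
  h A + h B - h (A ∪ B)

/-- The lower bound that a rank function `h` of seven subspaces gives for the dimension of
`fanoTriples`; the six subtracted terms are lines of the Fano plane. -/
def fanoBound (h : Finset (Fin 3 ⊕ Fin 4) → ℝ) : ℝ :=
  ∑ i, h {i} + 2 * h {inl 0, inl 2, inr 2} -
    (h {inl 0, inl 1, inr 0} + h {inl 1, inl 2, inr 1} + h {inl 0, inl 2, inr 3} +
      h {inl 2, inr 0, inr 2} + h {inl 0, inr 1, inr 2} + h {inl 1, inr 3, inr 2})

/-- The slack of `h` in a linear rank inequality valid over fields of characteristic other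
than two. -/
def oddGap (h : Finset (Fin 3 ⊕ Fin 4) → ℝ) : ℝ :=
  mutualRank h {inl 0} {inr 0, inr 1, inr 3} + mutualRank h {inl 1} {inr 0} +
    mutualRank h {inl 2} {inr 3} - fanoBound h

/-- The slack of `h` in a linear rank inequality valid over fields of characteristic two. -/
def evenGap (h : Finset (Fin 3 ⊕ Fin 4) → ℝ) : ℝ :=
  mutualRank h {inr 3} {inr 0, inr 1} + mutualRank h {inl 0} {inl 2} +
    mutualRank h {inl 1} {inr 2} - fanoBound h

section Subspaces

variable {ι F W : Type*} [Field F] [AddCommGroup W] [Module F W]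

theorem subspaceRank_eq_finrank_sup (V : ι → Submodule F W) (A : Finset ι) :
    subspaceRank V A = finrank F ↥(A.sup V) := by
  rw [subspaceRank, Finset.sup_eq_iSup]

theorem subspaceRank_singleton (V : ι → Submodule F W) (i : ι) :
    subspaceRank V {i} = finrank F (V i) := by
  rw [subspaceRank_eq_finrank_sup, Finset.sup_singleton]

variable [DecidableEq ι]

theorem subspaceRank_triple (V : ι → Submodule F W) (i j k : ι) :
    subspaceRank V {i, j, k} = finrank F ↥(V i ⊔ V j ⊔ V k) := by
  rw [subspaceRank_eq_finrank_sup, Finset.sup_insert, Finset.sup_insert, Finset.sup_singleton,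
    sup_assoc]

variable [FiniteDimensional F W]

theorem mutualRank_subspaceRank (V : ι → Submodule F W) (A B : Finset ι) :
    mutualRank (subspaceRank V) A B = finrank F ↥(A.sup V ⊓ B.sup V) := by
  rw [mutualRank, sub_eq_iff_eq_add']
  rw [subspaceRank_eq_finrank_sup, subspaceRank_eq_finrank_sup, subspaceRank_eq_finrank_sup,
    Finset.sup_union]
  exact_mod_cast (finrank_sup_add_finrank_inf_eq _ _).symm

variable (V : Fin 3 ⊕ Fin 4 → Submodule F W)

theorem fanoBound_subspaceRank_le :
    fanoBound (subspaceRank V) ≤ finrank F (fanoTriples (V (inl 0)) (V (inl 1)) (V (inl 2))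
      (V (inr 0)) (V (inr 1)) (V (inr 2)) (V (inr 3))) := by
  have h := le_finrank_fanoTriples (V (inl 0)) (V (inl 1)) (V (inl 2)) (V (inr 0)) (V (inr 1))
    (V (inr 2)) (V (inr 3))
  simp only [fanoBound, Fintype.sum_sum_type, Fin.sum_univ_three, Fin.sum_univ_four,
    subspaceRank_singleton, subspaceRank_triple]
  rify at h
  linarith

theorem oddGap_subspaceRank_nonneg (h2 : (2 : F) ≠ 0) : 0 ≤ oddGap (subspaceRank V) := by
  rw [oddGap, sub_nonneg]
  refine (fanoBound_subspaceRank_le V).trans ?_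
  rw [mutualRank_subspaceRank, mutualRank_subspaceRank, mutualRank_subspaceRank,
    Finset.sup_insert, Finset.sup_insert]
  repeat rw [Finset.sup_singleton]
  rw [← sup_assoc]
  exact_mod_cast finrank_fanoTriples_le_of_two_ne_zero h2

theorem evenGap_subspaceRank_nonneg [CharP F 2] : 0 ≤ evenGap (subspaceRank V) := by
  rw [evenGap, sub_nonneg]
  refine (fanoBound_subspaceRank_le V).trans ?_
  rw [mutualRank_subspaceRank, mutualRank_subspaceRank, mutualRank_subspaceRank,
    Finset.sup_insert]
  repeat rw [Finset.sup_singleton]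
  exact_mod_cast finrank_fanoTriples_le_of_charP_two

end Subspaces

section Limits

theorem nonneg_of_tendsto_smul {E : Type*} [TopologicalSpace E] [SMul ℝ E] {L : E → ℝ}
    (hL : Continuous L) (hsmul : ∀ (s : ℝ) x, L (s • x) = s * L x) {c : ℕ → ℝ} {g : ℕ → E} {x : E}
    (hc : ∀ i, 0 < c i) (hlim : Tendsto (fun i => c i • g i) atTop (𝓝 x))
    (hg : ∀ i, 0 ≤ L (g i)) : 0 ≤ L x :=
  ge_of_tendsto' ((hL.tendsto x).comp hlim) fun i => by
    rw [Function.comp_apply, hsmul]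
    exact mul_nonneg (hc i).le (hg i)

theorem two_ne_zero_of_odd_charP {R : Type*} [NonAssocSemiring R] [Nontrivial R] {p : ℕ}
    [CharP R p] (hp : Odd p) : (2 : R) ≠ 0 :=
  Ring.two_ne_zero fun h => by
    rw [ringChar.eq R p] at h
    exact absurd (h ▸ hp) (by decide)

theorem charP_of_natCard_eq_prime_pow {F : Type*} [Field F] [Finite F] {p m : ℕ}
    (hp : p.Prime) (hcard : Nat.card F = p ^ m) : CharP F p := by
  have := Fact.mk hp
  have := Fintype.ofFinite F
  exact charP_of_card_eq_prime_pow (Nat.card_eq_fintype_card (α := F) ▸ hcard)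

variable {h : Finset (Fin 3 ⊕ Fin 4) → ℝ}

theorem IsOddRepresentable.oddGap_nonneg (hh : IsOddRepresentable h) : 0 ≤ oddGap h := by
  obtain ⟨p, m, hp, hodd, -, F, _, _, W, _, _, _, V, hcard, hV⟩ := hh
  have := charP_of_natCard_eq_prime_pow hp hcard
  exact funext hV ▸ oddGap_subspaceRank_nonneg V (two_ne_zero_of_odd_charP hodd)

theorem IsEvenRepresentable.evenGap_nonneg (hh : IsEvenRepresentable h) : 0 ≤ evenGap h := by
  obtain ⟨m, -, F, _, _, W, _, _, _, V, hcard, hV⟩ := hh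
  have := charP_of_natCard_eq_prime_pow Nat.prime_two hcard
  exact funext hV ▸ evenGap_subspaceRank_nonneg V

theorem IsAlmostOddRepresentable.oddGap_nonneg (hh : IsAlmostOddRepresentable h) :
    0 ≤ oddGap h := by
  obtain ⟨g, c, hg, hc, hlim⟩ := hh
  refine nonneg_of_tendsto_smul ?_ (fun s x => ?_) hc hlim fun i => (hg i).oddGap_nonneg
  · unfold oddGap mutualRank fanoBound
    fun_prop
  · simp only [oddGap, mutualRank, fanoBound, Pi.smul_apply, smul_eq_mul, ← Finset.mul_sum]
    ring

theorem IsAlmostEvenRepresentable.evenGap_nonneg (hh : IsAlmostEvenRepresentable h) :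
    0 ≤ evenGap h := by
  obtain ⟨g, c, hg, hc, hlim⟩ := hh
  refine nonneg_of_tendsto_smul ?_ (fun s x => ?_) hc hlim fun i => (hg i).evenGap_nonneg
  · unfold evenGap mutualRank fanoBound
    fun_prop
  · simp only [evenGap, mutualRank, fanoBound, Pi.smul_apply, smul_eq_mul, ← Finset.mul_sum]
    ring

end Limits

end Inequalities

section Restriction

variable {ι κ : Type*} [DecidableEq κ]

theorem subspaceRank_image {F W : Type*} [Field F] [AddCommGroup W] [Module F W]
    (V : κ → Submodule F W) (e : ι → κ) (A : Finset ι) :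
    subspaceRank V (A.image e) = subspaceRank (V ∘ e) A := by
  rw [subspaceRank, subspaceRank, Finset.iSup_finset_image]
  rfl

variable {h : Finset κ → ℝ}

theorem IsQRepresentable.comp_image {q : ℕ} (hh : IsQRepresentable q h) (e : ι → κ) :
    IsQRepresentable q fun A => h (A.image e) := by
  obtain ⟨F, _, _, W, _, _, _, V, hcard, hV⟩ := hh
  exact ⟨F, _, ‹_›, W, _, _, ‹_›, V ∘ e, hcard, fun A =>
    (hV _).trans (subspaceRank_image V e A)⟩

theorem IsAlmostEvenRepresentable.comp_image (hh : IsAlmostEvenRepresentable h) (e : ι → κ) :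
    IsAlmostEvenRepresentable fun A => h (A.image e) := by
  obtain ⟨g, c, hg, hc, hlim⟩ := hh
  refine ⟨fun i A => g i (A.image e), c, fun i => ?_, hc, ?_⟩
  · obtain ⟨m, hm, hrep⟩ := hg i
    exact ⟨m, hm, hrep.comp_image e⟩
  · exact tendsto_pi_nhds.2 fun A => tendsto_pi_nhds.1 hlim (A.image e)

/-- Labels, among the thirteen lines of `Φ₂ F u`, of the seven lines spanned by `u 0`, `u 1`, `u 2`
and their sums, in the order of `vectors₁`. -/
def fanoLabels : Fin 3 ⊕ Fin 4 → Fin 5 ⊕ Fin 8 :=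
  Sum.map (Fin.castLE (by decide)) ![2, 4, 0, 3]

theorem Φ₂_image_fanoLabels {F W : Type*} [Field F] [AddCommGroup W] [Module F W] (u : Fin 5 → W)
    (A : Finset (Fin 3 ⊕ Fin 4)) :
    Φ₂ F u (A.image fanoLabels) = Φ₁ F (u ∘ Fin.castLE (by decide)) A := by
  have hvec : vectors₂ u ∘ fanoLabels = vectors₁ (u ∘ Fin.castLE (by decide : 3 ≤ 5)) := by
    funext i
    rcases i with i | i <;> fin_cases i <;> rfl
  rw [Φ₁, ← hvec]
  exact subspaceRank_image _ _ A

end Restriction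

section Representability

variable {ι F W : Type*} [Field F] [AddCommGroup W] [Module F W]

theorem subspaceRank_map {F' W' : Type*} [Field F'] [AddCommGroup W'] [Module F' W']
    {σ : F →+* F'} {σ' : F' →+* F} [RingHomInvPair σ σ'] [RingHomInvPair σ' σ] (f : W →ₛₗ[σ] W')
    (hf : Function.Injective f) (V : ι → Submodule F W) :
    subspaceRank (fun i => (V i).map f) = subspaceRank V := by
  funext A
  let e := equivMapOfInjective f hf (⨆ i ∈ A, V i)
  have hσ : Function.Bijective σ := (RingHomInvPair.toRingEquiv σ σ').bijective
  have hrank := congrArg Cardinal.toNat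
    (lift_rank_eq_of_equiv_equiv σ e.toAddEquiv hσ fun r x => e.map_smulₛₗ r x)
  rw [Cardinal.toNat_lift, Cardinal.toNat_lift] at hrank
  have hmap : ⨆ i ∈ A, (V i).map f = (⨆ i ∈ A, V i).map f := by
    simp only [Submodule.map_iSup]
  rw [subspaceRank, hmap]
  exact congrArg Nat.cast hrank.symm

-- `IsQRepresentable` asks for a field and a space in `Type`: transport coordinates along the
-- semilinear isomorphism `(Fin n → F) ≃ (Fin n → Shrink F)`.
theorem isQRepresentable_subspaceRank_of_finiteDimensional [Finite F] [FiniteDimensional F W]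
    (V : ι → Submodule F W) : IsQRepresentable (Nat.card F) (subspaceRank V) := by
  let e : F ≃+* Shrink.{0} F := (Shrink.ringEquiv.{0} F).symm
  have := RingHomInvPair.of_ringEquiv e
  have := RingHomInvPair.of_ringEquiv e.symm
  let coords : W ≃ₗ[F] (Fin (finrank F W) → F) := (finBasis F W).equivFun
  let f : W →ₛₗ[(e : F →+* Shrink.{0} F)] (Fin (finrank F W) → Shrink.{0} F) :=
    { toFun := fun x i => e (coords x i)
      map_add' := fun x y => funext fun i => by simp only [map_add, Pi.add_apply]
      map_smul' := fun r x => funext fun i => by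
        simp only [map_smul, Pi.smul_apply, smul_eq_mul, map_mul, RingHom.coe_coe] }
  have hf : Function.Injective f := fun x y hxy =>
    coords.injective (funext fun i => e.injective (congrFun hxy i))
  exact ⟨Shrink.{0} F, inferInstance, Finite.of_equiv F e, _, inferInstance, inferInstance,
    inferInstance, fun i => (V i).map f, (Nat.card_congr e.toEquiv).symm,
    fun A => (congrFun (subspaceRank_map f hf V) A).symm⟩

theorem isQRepresentable_subspaceRank [Finite F] [Finite ι] (V : ι → Submodule F W)
    [∀ i, FiniteDimensional F (V i)] : IsQRepresentable (Nat.card F) (subspaceRank V) := by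
  have hV : (fun i => ((V i).comap (⨆ j, V j).subtype).map (⨆ j, V j).subtype) = V :=
    funext fun i => by rw [map_comap_subtype, inf_eq_right.2 (le_iSup V i)]
  rw [← hV, subspaceRank_map _ (injective_subtype _)]
  exact isQRepresentable_subspaceRank_of_finiteDimensional _

theorem exists_natCard_eq_prime_pow (F : Type*) [Field F] [Finite F] (p : ℕ) [CharP F p] :
    ∃ m : ℕ, p.Prime ∧ 0 < m ∧ Nat.card F = p ^ m := by
  have := Fintype.ofFinite F
  obtain ⟨m, hp, hm⟩ := FiniteField.card F p
  exact ⟨m, hp, m.pos, Nat.card_eq_fintype_card.trans hm⟩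

end Representability

section Matroid

variable {ι F W : Type*} [DecidableEq ι] [Field F] [AddCommGroup W] [Module F W]

theorem isPolymatroid_subspaceRank (V : ι → Submodule F W) [∀ i, FiniteDimensional F (V i)] :
    IsPolymatroid (subspaceRank V) where
  nonneg A := Nat.cast_nonneg _
  empty := by
    rw [subspaceRank_eq_finrank_sup, Finset.sup_empty, finrank_bot, Nat.cast_zero]
  mono A B hAB := by
    rw [subspaceRank_eq_finrank_sup, subspaceRank_eq_finrank_sup, Nat.cast_le]
    exact finrank_mono (Finset.sup_mono hAB)
  submodular A B := by
    have hinter : finrank F ↥((A ∩ B).sup V) ≤ finrank F ↥(A.sup V ⊓ B.sup V) :=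
      finrank_mono (le_inf (Finset.sup_mono Finset.inter_subset_left)
        (Finset.sup_mono Finset.inter_subset_right))
    have hunion := finrank_sup_add_finrank_inf_eq (A.sup V) (B.sup V)
    rw [← Finset.sup_union] at hunion
    simp only [subspaceRank_eq_finrank_sup]
    exact_mod_cast (by omega)

theorem isMatroid_subspaceRank_span_singleton (v : ι → W) :
    IsMatroid (subspaceRank fun i => span F {v i}) where
  toIsPolymatroid := isPolymatroid_subspaceRank _
  le_card A := by
    classical
    have hspan : ⨆ i ∈ A, span F {v i} = span F (A.image v : Finset W) := by
      rw [Finset.coe_image, Set.image_eq_iUnion, span_iUnion₂]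
      rfl
    rw [subspaceRank, hspan, Nat.cast_le]
    exact (finrank_span_finset_le_card _).trans Finset.card_image_le
  integral A := ⟨_, (Int.cast_natCast _).symm⟩

theorem IsMatroid.eq_card_of_subset {h : Finset ι → ℝ} (hh : IsMatroid h) {A B : Finset ι}
    (hA : h A = A.card) (hBA : B ⊆ A) : h B = B.card := by
  have hunion := hh.submodular B (A \ B)
  rw [Finset.union_sdiff_of_subset hBA, Finset.inter_sdiff_self, hh.empty, hA,
    ← Finset.card_sdiff_add_card_eq_card hBA, Nat.cast_add] at hunion
  linarith [hh.le_card B, hh.le_card (A \ B)]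

theorem IsMatroid.mutualRank_eq_zero {h : Finset ι → ℝ} (hh : IsMatroid h) {A B : Finset ι}
    (hAB : Disjoint A B) (hunion : h (A ∪ B) = (A ∪ B).card) : mutualRank h A B = 0 := by
  rw [mutualRank, hunion, hh.eq_card_of_subset hunion Finset.subset_union_left,
    hh.eq_card_of_subset hunion Finset.subset_union_right, Finset.card_union_of_disjoint hAB,
    Nat.cast_add, sub_self]

end Matroid

section Fano

open Sum (inl inr)

variable {ι F W : Type*} [DecidableEq ι] [Field F] [AddCommGroup W] [Module F W]

theorem subspaceRank_span_singleton_image {κ : Type*} [Fintype κ] {v : ι → W} {e : κ → ι}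
    (hv : LinearIndependent F (v ∘ e)) :
    subspaceRank (fun i => span F {v i}) (Finset.univ.image e) = (Finset.univ.image e).card := by
  rw [subspaceRank_image, Finset.card_image_of_injective _ hv.injective.of_comp, Finset.card_univ,
    subspaceRank_eq_finrank_sup, Finset.sup_univ_eq_iSup, ← finrank_span_eq_card hv,
    span_range_eq_iSup]
  rfl

theorem subspaceRank_span_singleton_le_two {v : ι → W} {i j k : ι}
    (hv : v i + v j = v k) : subspaceRank (fun i => span F {v i}) {i, j, k} ≤ 2 := by
  classical
  have hspan : span F {v i} ⊔ span F {v j} ⊔ span F {v k} ≤ span F ({v i, v j} : Finset W) := by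
    rw [← hv, Finset.coe_pair, span_insert (v i), sup_le_iff, span_singleton_le_iff_mem]
    exact ⟨le_rfl, add_mem_sup (mem_span_singleton_self _) (mem_span_singleton_self _)⟩
  rw [subspaceRank_triple]
  exact_mod_cast (finrank_mono hspan).trans
    ((finrank_span_finset_le_card _).trans Finset.card_le_two)

variable {u : Fin 3 → W}

theorem vectors₁_map {W' : Type*} [AddCommGroup W'] [Module F W'] (f : W →ₗ[F] W')
    (i : Fin 3 ⊕ Fin 4) : vectors₁ (f ∘ u) i = f (vectors₁ u i) := by
  rcases i with i | i
  · rfl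
  · fin_cases i <;> simp [vectors₁]

theorem Φ₁_map {W' : Type*} [AddCommGroup W'] [Module F W'] {f : W →ₗ[F] W'}
    (hf : Function.Injective f) : Φ₁ F (f ∘ u) = Φ₁ F u := by
  rw [Φ₁, Φ₁, ← subspaceRank_map f hf]
  simp only [vectors₁_map, map_span, Set.image_singleton]

theorem Φ₁_eq_of_linearIndependent (hu : LinearIndependent F u) :
    Φ₁ F u = Φ₁ F fun i => (Pi.single i 1 : Fin 3 → F) := by
  rw [← Φ₁_map (linearIndependent_iff_injective_fintypeLinearCombination.1 hu)]
  congr 1 with i : 1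
  simp

theorem Φ₁_eq_card_of_subset_image (hu : LinearIndependent F u) (e : Fin 3 → Fin 3 ⊕ Fin 4)
    (he : (Matrix.of (vectors₁ (fun i => (Pi.single i 1 : Fin 3 → F)) ∘ e)).det ≠ 0)
    {A : Finset (Fin 3 ⊕ Fin 4)} (hA : A ⊆ Finset.univ.image e) : Φ₁ F u A = A.card := by
  rw [Φ₁_eq_of_linearIndependent hu]
  exact (isMatroid_subspaceRank_span_singleton _).eq_card_of_subset
    (subspaceRank_span_singleton_image (Matrix.linearIndependent_rows_of_det_ne_zero he)) hA

theorem Φ₁_singleton (hu : LinearIndependent F u) (i : Fin 3 ⊕ Fin 4) : Φ₁ F u {i} = 1 := by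
  have hne : vectors₁ (fun i => (Pi.single i 1 : Fin 3 → F)) i ≠ 0 := by
    rcases i with i | i <;> fin_cases i <;>
      simp [vectors₁, funext_iff, Fin.forall_fin_succ]
  rw [Φ₁_eq_of_linearIndependent hu, Φ₁, subspaceRank_singleton, finrank_span_singleton hne,
    Nat.cast_one]

theorem one_le_fanoBound_Φ₁ (hu : LinearIndependent F u) : 1 ≤ fanoBound (Φ₁ F u) := by
  have hbasis : Φ₁ F u {inl 0, inl 2, inr 2} = 3 :=
    Φ₁_eq_card_of_subset_image hu ![inl 0, inl 2, inr 2]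
      (by simp [Matrix.det_fin_three, vectors₁]) (by decide)
  have h₁ : Φ₁ F u {inl 0, inl 1, inr 0} ≤ 2 := subspaceRank_span_singleton_le_two rfl
  have h₂ : Φ₁ F u {inl 1, inl 2, inr 1} ≤ 2 := subspaceRank_span_singleton_le_two rfl
  have h₃ : Φ₁ F u {inl 0, inl 2, inr 3} ≤ 2 := subspaceRank_span_singleton_le_two rfl
  have h₄ : Φ₁ F u {inl 2, inr 0, inr 2} ≤ 2 :=
    subspaceRank_span_singleton_le_two (add_comm (u 2) (u 0 + u 1))
  have h₅ : Φ₁ F u {inl 0, inr 1, inr 2} ≤ 2 :=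
    subspaceRank_span_singleton_le_two (add_assoc (u 0) (u 1) (u 2)).symm
  have h₆ : Φ₁ F u {inl 1, inr 3, inr 2} ≤ 2 :=
    subspaceRank_span_singleton_le_two (add_left_comm (u 1) (u 0) (u 2) |>.trans
      (add_assoc (u 0) (u 1) (u 2)).symm)
  have hsum : ∑ i, Φ₁ F u {i} = 7 := by
    simp only [Φ₁_singleton hu, Finset.sum_const, Finset.card_univ, Fintype.card_sum,
      Fintype.card_fin]
    norm_num
  rw [fanoBound, hsum, hbasis]
  linarith

theorem oddGap_Φ₁_neg [CharP F 2] (hu : LinearIndependent F u) : oddGap (Φ₁ F u) < 0 := by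
  have hM : IsMatroid (Φ₁ F u) := isMatroid_subspaceRank_span_singleton _
  have hline : Φ₁ F u {inr 0, inr 1, inr 3} ≤ 2 :=
    subspaceRank_span_singleton_le_two (add_add_add_eq_of_charP_two F (u 0) (u 1) (u 2))
  have hspan : 3 ≤ Φ₁ F u ({inl 0} ∪ {inr 0, inr 1, inr 3}) := by
    have hbasis : Φ₁ F u {inl 0, inr 0, inr 3} = 3 :=
      Φ₁_eq_card_of_subset_image hu ![inl 0, inr 0, inr 3]
        (by simp [Matrix.det_fin_three, vectors₁]) (by decide)
    exact hbasis ▸ hM.mono _ _ (by decide)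
  have hbp : mutualRank (Φ₁ F u) {inl 1} {inr 0} = 0 := hM.mutualRank_eq_zero (by decide)
    (Φ₁_eq_card_of_subset_image hu ![inl 1, inr 0, inr 2]
      (by simp [Matrix.det_fin_three, vectors₁]) (by decide))
  have hcr : mutualRank (Φ₁ F u) {inl 2} {inr 3} = 0 := hM.mutualRank_eq_zero (by decide)
    (Φ₁_eq_card_of_subset_image hu ![inl 2, inr 1, inr 3]
      (by simp [Matrix.det_fin_three, vectors₁]) (by decide))
  rw [oddGap, hbp, hcr, mutualRank, Φ₁_singleton hu]
  linarith [one_le_fanoBound_Φ₁ hu]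

theorem evenGap_Φ₁_neg (h2 : (2 : F) ≠ 0) (hu : LinearIndependent F u) :
    evenGap (Φ₁ F u) < 0 := by
  have hM : IsMatroid (Φ₁ F u) := isMatroid_subspaceRank_span_singleton _
  have hrpq : mutualRank (Φ₁ F u) {inr 3} {inr 0, inr 1} = 0 := hM.mutualRank_eq_zero (by decide)
    (Φ₁_eq_card_of_subset_image hu ![inr 0, inr 1, inr 3]
      (by simpa [Matrix.det_fin_three, vectors₁, one_add_one_eq_two] using h2) (by decide))
  have hac : mutualRank (Φ₁ F u) {inl 0} {inl 2} = 0 := hM.mutualRank_eq_zero (by decide)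
    (Φ₁_eq_card_of_subset_image hu ![inl 0, inl 1, inl 2]
      (by simp [Matrix.det_fin_three, vectors₁]) (by decide))
  have hbd : mutualRank (Φ₁ F u) {inl 1} {inr 2} = 0 := hM.mutualRank_eq_zero (by decide)
    (Φ₁_eq_card_of_subset_image hu ![inl 1, inr 0, inr 2]
      (by simp [Matrix.det_fin_three, vectors₁]) (by decide))
  rw [evenGap, hrpq, hac, hbd]
  linarith [one_le_fanoBound_Φ₁ hu]

theorem not_isAlmostOddRepresentable_Φ₁ [CharP F 2] (hu : LinearIndependent F u) :
    ¬ IsAlmostOddRepresentable (Φ₁ F u) :=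
  fun h => h.oddGap_nonneg.not_gt (oddGap_Φ₁_neg hu)

theorem not_isAlmostEvenRepresentable_Φ₁ (h2 : (2 : F) ≠ 0) (hu : LinearIndependent F u) :
    ¬ IsAlmostEvenRepresentable (Φ₁ F u) :=
  fun h => h.evenGap_nonneg.not_gt (evenGap_Φ₁_neg h2 hu)

theorem not_isAlmostEvenRepresentable_Φ₂ (h2 : (2 : F) ≠ 0) {u : Fin 5 → W}
    (hu : LinearIndependent F u) : ¬ IsAlmostEvenRepresentable (Φ₂ F u) := by
  intro h
  have hrestrict := h.comp_image fanoLabels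
  simp only [Φ₂_image_fanoLabels] at hrestrict
  exact not_isAlmostEvenRepresentable_Φ₁ h2 (hu.comp _ (Fin.castLE_injective _)) hrestrict

end Fano

end SubspaceRank

open SubspaceRank in
theorem mainTheorem3 :
    (∀ (F : Type*) [Field F] [Finite F] [CharP F 2]
        (W : Type*) [AddCommGroup W] [Module F W]
        (u : Fin 3 → W), LinearIndependent F u →
      SubspaceRank.IsMatroid (SubspaceRank.Φ₁ F u) ∧
      SubspaceRank.IsEvenRepresentable (SubspaceRank.Φ₁ F u) ∧
      ¬ SubspaceRank.IsAlmostOddRepresentable (SubspaceRank.Φ₁ F u)) ∧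
    (∀ (F : Type*) [Field F] [Finite F] (p : ℕ) [CharP F p], Odd p →
      ∀ (W : Type*) [AddCommGroup W] [Module F W]
        (u : Fin 5 → W), LinearIndependent F u →
      SubspaceRank.IsMatroid (SubspaceRank.Φ₂ F u) ∧
      SubspaceRank.IsOddRepresentable (SubspaceRank.Φ₂ F u) ∧
      ¬ SubspaceRank.IsAlmostEvenRepresentable (SubspaceRank.Φ₂ F u)) := by
  refine ⟨fun F _ _ _ W _ _ u hu => ⟨isMatroid_subspaceRank_span_singleton _, ?_,
      not_isAlmostOddRepresentable_Φ₁ hu⟩,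
    fun F _ _ p _ hp W _ _ u hu => ⟨isMatroid_subspaceRank_span_singleton _, ?_,
      not_isAlmostEvenRepresentable_Φ₂ (two_ne_zero_of_odd_charP hp) hu⟩⟩
  · obtain ⟨m, -, hm, hcard⟩ := exists_natCard_eq_prime_pow F 2
    exact ⟨m, hm, hcard ▸ isQRepresentable_subspaceRank _⟩
  · obtain ⟨m, hprime, hm, hcard⟩ := exists_natCard_eq_prime_pow F p
    exact ⟨p, m, hprime, hp, hm, hcard ▸ isQRepresentable_subspaceRank _⟩
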